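/- For a finite commutative ring $R$ with $1$, let $K_0(R)$ be the simplicial complex whose vertices are the nonzero elements of $R$ and whose simplices are the nonempty sets $A\subseteq R\setminus\{0\}$ with $xy=0$ for all distinct $x,y\in A$. Let $K(R)$ be the clique complex of the zero-divisor graph of $R$, that is, the subcomplex of $K_0(R)$ induced on the nonzero zero-divisors of $R$. For $n\in\mathbb{Z}$, let $\tilde H_n$ denote reduced simplicial homology with integer coefficients, computed from the augmented simplicial chain complex (so $\tilde H_{-1}(\emptyset)=\mathbb{Z}$, and $\tilde H_n=0$ for $n<-1$). Let $\Omega$ be a finite commutative ring with $\Omega\cong R_1\times\cdots\times R_k$, where $k\ge 1$ and every $R_i$ is a finite local ring, and let $u_i$ be the number of units of $R_i$. Then $\tilde H_n(K(\Omega))$ is a free abelian group for every $n\in\mathbb{Z}$. Moreover, for every $n\in\mathbb{Z}$, except when $\Omega$ is a field and $n=-1$ (in that case $K(\Omega)=\emptyset$), $$\tilde H_n(K(\Omega))\;\cong\;\bigoplus_{j=1}^{k-1}\ \bigoplus_{1\le i_1<\cdots<i_j\le k-1}\tilde H_{n-1}\bigl(K_0(R_{i_1}\times\cdots\times R_{i_j})\bigr)^{m(i_1,\dots,i_j)},$$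 where $$m(i_1,\dots,i_j)=\prod_{i\in\{1,\dots,k\}\setminus\{i_1,\dots,i_j\}}u_i,$$ except that, when $R_k$ is a field, $m(1,\dots,k-1)=u_k-1$ (instead of $u_k$). -/

import Mathlib

open scoped DirectSum

noncomputable section

namespace ZeroDivisorComplex

universe u

/-! ### Reduced simplicial homology with integer coefficients -/

section Homology

variable {V : Type u}

/-- The sign of the vertex `v` in `s`: it is `(-1) ^ i`, where `i` is the position of `v`
(counted from `0`) when the vertices of `s` are listed in increasing order. -/
def vertexSign [LinearOrder V] (s : Finset V) (v : V) : ℤ :=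
  (-1) ^ (s.filter (fun w => w < v)).card

/-- The boundary operator on the free abelian group on all finite sets of vertices (including the
empty one), every set being oriented by the order of the vertices:
`∂[v₀, …, vₘ] = ∑ i, (-1) ^ i [v₀, …, v̂ᵢ, …, vₘ]`. In particular `∂[v] = [∅]`, so that
the augmentation is included. -/
def boundary (V : Type u) [LinearOrder V] : (Finset V →₀ ℤ) →ₗ[ℤ] (Finset V →₀ ℤ) :=
  Finsupp.linearCombination ℤ
    (fun s : Finset V => ∑ v ∈ s, Finsupp.single (s.erase v) (vertexSign s v))

theorem boundary_single [LinearOrder V] (s : Finset V) (c : ℤ) :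
    boundary V (Finsupp.single s c)
      = c • ∑ v ∈ s, Finsupp.single (s.erase v) (vertexSign s v) := by
  simp [boundary]

theorem vertexSign_erase_of_lt [LinearOrder V] {s : Finset V} {v w : V} (hv : v ∈ s)
    (h : v < w) : vertexSign (s.erase v) w = -vertexSign s w := by
  have hmem : v ∈ s.filter (fun x => x < w) := by simp [hv, h]
  have h1 : (s.filter (fun x => x < w)).card
      = ((s.erase v).filter (fun x => x < w)).card + 1 := by
    rw [Finset.filter_erase, Finset.card_erase_add_one hmem]
  unfold vertexSign
  rw [h1, pow_succ]
  ring

theorem vertexSign_erase_of_gt [LinearOrder V] {s : Finset V} {v w : V}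
    (h : w < v) : vertexSign (s.erase v) w = vertexSign s w := by
  unfold vertexSign
  rw [Finset.filter_erase, Finset.erase_eq_of_notMem]
  simp [h.le]

theorem vertexSign_mul [LinearOrder V] {s : Finset V} {v w : V} (hv : v ∈ s) (hw : w ∈ s)
    (h : v ≠ w) :
    vertexSign s v * vertexSign (s.erase v) w = -(vertexSign s w * vertexSign (s.erase w) v) := by
  rcases lt_or_gt_of_ne h with h | h
  · rw [vertexSign_erase_of_lt hv h, vertexSign_erase_of_gt h]; ring
  · rw [vertexSign_erase_of_gt h, vertexSign_erase_of_lt hw h]; ring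

theorem boundary_boundary [LinearOrder V] (x : Finset V →₀ ℤ) :
    boundary V (boundary V x) = 0 := by
  induction x using Finsupp.induction_linear with
  | zero => simp
  | add f g hf hg => simp [hf, hg]
  | single s c =>
    rw [boundary_single, map_smul, map_sum]
    have key : ∑ v ∈ s, boundary V (Finsupp.single (s.erase v) (vertexSign s v)) = 0 := by
      have h1 : ∀ v ∈ s, boundary V (Finsupp.single (s.erase v) (vertexSign s v))
          = ∑ w ∈ s.erase v, Finsupp.single ((s.erase v).erase w)
              (vertexSign s v * vertexSign (s.erase v) w) := by
        intro v _
        rw [boundary_single, Finset.smul_sum]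
        simp
      rw [Finset.sum_congr rfl h1, Finset.sum_sigma']
      refine Finset.sum_involution (fun p _ => ⟨p.2, p.1⟩) ?_ ?_ ?_ ?_
      · rintro ⟨v, w⟩ hp
        simp only [Finset.mem_sigma, Finset.mem_erase] at hp
        obtain ⟨hv, hwv, hw⟩ := hp
        simp only
        rw [Finset.erase_right_comm (a := w) (b := v), ← Finsupp.single_add,
          vertexSign_mul hv hw (Ne.symm hwv)]
        simp
      · rintro ⟨v, w⟩ hp _ heq
        simp only [Finset.mem_sigma, Finset.mem_erase] at hp
        exact hp.2.1 (congrArg Sigma.fst heq)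
      · rintro ⟨v, w⟩ hp
        simp only [Finset.mem_sigma, Finset.mem_erase] at hp ⊢
        exact ⟨hp.2.2, Ne.symm hp.2.1, hp.1⟩
      · rintro ⟨v, w⟩ _
        rfl
    rw [key, smul_zero]

/-- The simplices of `K` of dimension `n`, the empty set being the only one of dimension `-1`. -/
def simplices (K : PreAbstractSimplicialComplex V) (n : ℤ) : Set (Finset V) :=
  {s | (s = ∅ ∨ s ∈ K) ∧ (s.card : ℤ) = n + 1}

/-- The group `C̃ₙ(K)` of (augmented) `n`-chains: formal integer combinations of the
`n`-dimensional simplices of `K`. It is zero for `n < -1`, and `ℤ` for `n = -1`. -/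
def chains (K : PreAbstractSimplicialComplex V) (n : ℤ) : Submodule ℤ (Finset V →₀ ℤ) :=
  Finsupp.supported ℤ ℤ (simplices K n)

theorem boundary_mem_chains [LinearOrder V] (K : PreAbstractSimplicialComplex V) {i j : ℤ}
    (hij : j + 1 = i) (x : Finset V →₀ ℤ) (hx : x ∈ chains K i) : boundary V x ∈ chains K j := by
  rw [boundary, Finsupp.linearCombination_apply]
  refine Submodule.sum_mem _ fun s hs => Submodule.smul_mem _ _ (Submodule.sum_mem _ fun v hv => ?_)
  obtain ⟨hK, hcard⟩ := hx hs
  refine Finsupp.single_mem_supported ℤ _ ⟨?_, ?_⟩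
  · rcases (s.erase v).eq_empty_or_nonempty with h | h
    · exact Or.inl h
    · rcases hK with rfl | hK
      · simp at hv
      · exact Or.inr ((K.isRelLowerSet_faces hK).2 (Finset.erase_subset v s) h)
  · have := Finset.card_erase_add_one hv
    omega

/-- The boundary homomorphism `C̃ᵢ(K) → C̃ⱼ(K)` for `i = j + 1`. -/
def chainBoundary [LinearOrder V] (K : PreAbstractSimplicialComplex V) {i j : ℤ}
    (hij : j + 1 = i) : chains K i →ₗ[ℤ] chains K j :=
  (boundary V).restrict (boundary_mem_chains K hij)

/-- The augmented simplicial chain complex of `K`, for a given ordering of the vertices. -/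
def augmentedChainComplex [LinearOrder V] (K : PreAbstractSimplicialComplex V) :
    ChainComplex (ModuleCat.{u} ℤ) ℤ where
  X n := ModuleCat.of ℤ (chains K n)
  d i j := if hij : j + 1 = i then ModuleCat.ofHom (chainBoundary K hij) else 0
  shape i j hij := dif_neg hij
  d_comp_d' i j l hij hjl := by
    rw [dif_pos (show j + 1 = i from hij), dif_pos (show l + 1 = j from hjl),
      ← ModuleCat.ofHom_comp]
    ext x
    exact DFunLike.congr_fun (boundary_boundary (x : Finset V →₀ ℤ)) _

/-- The reduced simplicial homology group `H̃ₙ(K)`, `n ∈ ℤ`, with integer coefficients. To write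
down the chain complex the vertices are ordered by some well-order; the group does not depend on
this choice up to isomorphism. -/
def reducedHomology (K : PreAbstractSimplicialComplex V) (n : ℤ) : ModuleCat.{u} ℤ :=
  letI : LinearOrder V :=
    haveI := Classical.decRel (WellOrderingRel (α := V))
    linearOrderOfSTO (WellOrderingRel (α := V))
  (augmentedChainComplex K).homology n

end Homology

/-! ### The complexes attached to a commutative ring -/

/-- The clique complex of a graph: its simplices are the nonempty finite cliques. -/
def cliqueComplex {V : Type u} (G : SimpleGraph V) : AbstractSimplicialComplex V where
  faces := {s | s.Nonempty ∧ G.IsClique (s : Set V)}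
  isRelLowerSet_faces := fun _ hs =>
    ⟨hs.1, fun _ hts ht => ⟨ht, hs.2.subset (Finset.coe_subset.mpr hts)⟩⟩
  singleton_mem v := by simp

/-- The graph on all elements of `R` in which distinct `x`, `y` are adjacent if `x * y = 0`. -/
def annihilationGraph (R : Type u) [CommRing R] : SimpleGraph R where
  Adj x y := x ≠ y ∧ x * y = 0
  symm := ⟨fun x y h => ⟨h.1.symm, by rw [mul_comm]; exact h.2⟩⟩
  loopless := ⟨fun _ h => h.1 rfl⟩

/-- The set `Z(R)^*` of nonzero zero-divisors of `R`. -/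
def nonzeroZeroDivisors (R : Type u) [CommRing R] : Set R :=
  {x | x ≠ 0 ∧ ∃ y : R, y ≠ 0 ∧ x * y = 0}

/-- The zero-divisor graph `Γ(R)`: the induced graph on the nonzero zero-divisors. -/
def zeroDivisorGraph (R : Type u) [CommRing R] : SimpleGraph (nonzeroZeroDivisors R) :=
  (annihilationGraph R).induce (nonzeroZeroDivisors R)

/-- The complex `K(R)`: the clique complex of the zero-divisor graph. -/
def K (R : Type u) [CommRing R] : PreAbstractSimplicialComplex (nonzeroZeroDivisors R) :=
  (cliqueComplex (zeroDivisorGraph R)).toPreAbstractSimplicialComplex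

/-- The complex `K₀(R)`: its vertices are the nonzero elements of `R`, and its simplices are the
sets of nonzero elements in which any two distinct elements have product zero. -/
def K₀ (R : Type u) [CommRing R] : PreAbstractSimplicialComplex {x : R | x ≠ 0} :=
  (cliqueComplex ((annihilationGraph R).induce {x : R | x ≠ 0})).toPreAbstractSimplicialComplex

/-- For local rings `R₀, …, Rₖ` with unit counts `uᵢ`, the exponent attached to a subset
`I ⊆ {0, …, k - 1}`: it is the product of the `uᵢ` over all `i ∈ {0, …, k}` not in `I`, except
that for `I = {0, …, k - 1}` it is `uₖ - 1` if `Rₖ` is a field. -/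
def exponent {k : ℕ} (R : Fin (k + 1) → Type u) [∀ i, CommRing (R i)] (I : Finset (Fin k)) : ℕ :=
  open Classical in
  if I = Finset.univ ∧ IsField (R (Fin.last k)) then Nat.card (R (Fin.last k))ˣ - 1
  else (∏ i ∈ Iᶜ, Nat.card (R i.castSucc)ˣ) * Nat.card (R (Fin.last k))ˣ

end ZeroDivisorComplex

end

noncomputable section

namespace ZeroDivisorComplex

universe u

/-! ### Homology of a family of finite sets -/

section Family

/-! Each finite local ring contains a nonzero `s` killed by all nonunits. Take such an `s` in the
last factor and let `c` be the vector with last entry `s` and zeros elsewhere. Let `W` be the set of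
vertices other than `c` whose last entry is a unit. Two members of `W` never have product zero, so a
simplex meets `W` at most once. Every vertex outside `W` is `c` or is killed by `c`, so the
simplices avoiding `W` form a cone with apex `c`. The complex is thus a cone with a further cone
attached over the link of each `w` in `W`, and its homology is the sum of the homologies of these
links, shifted by one (`nonempty_familyHomology_equiv_pi_link`).

The link of `w` is spanned by the vertices that annihilate `w`. If an entry of `w` is neither zero
nor a unit, the link is itself a cone and contributes nothing. Otherwise it is `K₀` of the product
of the factors where `w` vanishes (`nonempty_familyHomology_product_equiv`). Counting the remaining
`w` by zero set gives the exponents; the correction by one occurs when `c` itself would be counted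
(`ncard_zeroUnitSet_diff`). The same decomposition applied to `K₀` gives freeness by induction on
the set of factors.

To compare all these complexes, they are realised as families of finite subsets of the one set `∏ R
i`, with the empty face included. -/

theorem map_supported_le {α β : Type*} (T : (α →₀ ℤ) →ₗ[ℤ] (β →₀ ℤ)) {A : Set α} {B : Set β}
    (h : ∀ s ∈ A, T (Finsupp.single s 1) ∈ Finsupp.supported ℤ ℤ B) {x : α →₀ ℤ}
    (hx : x ∈ Finsupp.supported ℤ ℤ A) : T x ∈ Finsupp.supported ℤ ℤ B := by
  have : Finsupp.supported ℤ ℤ A ≤ (Finsupp.supported ℤ ℤ B).comap T := by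
    rw [Finsupp.supported_eq_span_single, Submodule.span_le]
    rintro _ ⟨s, hs, rfl⟩
    exact h s hs
  exact this hx

theorem eqOn_supported {α M : Type*} [AddCommGroup M] (T T' : (α →₀ ℤ) →ₗ[ℤ] M) {A : Set α}
    (h : ∀ s ∈ A, T (Finsupp.single s 1) = T' (Finsupp.single s 1)) {x : α →₀ ℤ}
    (hx : x ∈ Finsupp.supported ℤ ℤ A) : T x = T' x := by
  have : Finsupp.supported ℤ ℤ A ≤ LinearMap.eqLocus T T' := by
    rw [Finsupp.supported_eq_span_single, Submodule.span_le]
    rintro _ ⟨s, hs, rfl⟩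
    exact h s hs
  exact this hx

variable {V : Type*} [LinearOrder V]

theorem vertexSign_mul_self (s : Finset V) (v : V) : vertexSign s v * vertexSign s v = 1 := by
  unfold vertexSign
  rw [← mul_pow]
  simp

theorem vertexSign_insert_self (s : Finset V) (v : V) :
    vertexSign (insert v s) v = vertexSign s v := by
  unfold vertexSign
  rw [Finset.filter_insert, if_neg (lt_irrefl v)]

theorem vertexSign_erase_self (s : Finset V) (v : V) :
    vertexSign (s.erase v) v = vertexSign s v := by
  unfold vertexSign
  rw [Finset.filter_erase, Finset.erase_eq_of_notMem]
  simp

/-- The interior product with `v`: it removes the vertex `v`, with a sign. -/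
def contract (v : V) : (Finset V →₀ ℤ) →ₗ[ℤ] (Finset V →₀ ℤ) :=
  Finsupp.linearCombination ℤ fun s =>
    if v ∈ s then Finsupp.single (s.erase v) (vertexSign s v) else 0

/-- The cone operator with apex `v`: it adds the vertex `v`, with a sign. -/
def cone (v : V) : (Finset V →₀ ℤ) →ₗ[ℤ] (Finset V →₀ ℤ) :=
  Finsupp.linearCombination ℤ fun s =>
    if v ∈ s then 0 else Finsupp.single (insert v s) (vertexSign s v)

theorem contract_single (v : V) (s : Finset V) (c : ℤ) : contract v (Finsupp.single s c)
    = if v ∈ s then Finsupp.single (s.erase v) (c * vertexSign s v) else 0 := by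
  rw [contract, Finsupp.linearCombination_single]
  split_ifs <;> simp

theorem cone_single (v : V) (s : Finset V) (c : ℤ) : cone v (Finsupp.single s c)
    = if v ∈ s then 0 else Finsupp.single (insert v s) (c * vertexSign s v) := by
  rw [cone, Finsupp.linearCombination_single]
  split_ifs <;> simp

/-- Distinct sets containing `v` stay distinct after `v` is removed, so nothing cancels. Hence a
chain with zero contraction involves no set through `v`. -/
theorem contract_apply_erase (v : V) {s : Finset V} (hv : v ∈ s) (x : Finset V →₀ ℤ) :
    contract v x (s.erase v) = vertexSign s v * x s := by
  induction x using Finsupp.induction_linear with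
  | zero => simp
  | add f g hf hg => simp [hf, hg, mul_add]
  | single t c =>
    rw [contract_single]
    by_cases ht : t = s
    · subst ht
      simp [hv, mul_comm]
    · have h1 : v ∈ t → t.erase v ≠ s.erase v := fun h h' => ht (by
        rw [← Finset.insert_erase h, h', Finset.insert_erase hv])
      split_ifs with h
      · rw [Finsupp.single_eq_of_ne (h1 h).symm, Finsupp.single_eq_of_ne (Ne.symm ht), mul_zero]
      · rw [Finsupp.single_eq_of_ne (Ne.symm ht)]; simp

theorem boundary_contract (v : V) (x : Finset V →₀ ℤ) :
    boundary V (contract v x) = -contract v (boundary V x) := by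
  suffices boundary V ∘ₗ contract v = -(contract v ∘ₗ boundary V) from LinearMap.congr_fun this x
  ext1 s
  refine LinearMap.ext_ring ?_
  simp only [LinearMap.comp_apply, LinearMap.neg_apply, Finsupp.lsingle_apply]
  rw [contract_single, boundary_single, one_smul, map_sum]
  simp only [contract_single, Finset.mem_erase]
  split_ifs with hv
  · rw [boundary_single, ← Finset.add_sum_erase s _ hv, Finset.smul_sum]
    simp only [ne_eq, not_true_eq_false, false_and, if_false, zero_add, one_mul]
    rw [← Finset.sum_neg_distrib]
    refine Finset.sum_congr rfl fun w hw => ?_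
    obtain ⟨hwv, hw⟩ := Finset.mem_erase.mp hw
    rw [if_pos ⟨Ne.symm hwv, hv⟩, Finsupp.smul_single, smul_eq_mul,
      vertexSign_mul hv hw (Ne.symm hwv), Finset.erase_right_comm, Finsupp.single_neg]
  · simp [hv]

/-- This is the homotopy that contracts a cone. If `v ∉ s`, deleting `v` from `insert v s` returns
`s` and the other terms cancel; if `v ∈ s`, only the term of `∂s` without `v` survives coning. -/
theorem boundary_cone (v : V) (x : Finset V →₀ ℤ) :
    boundary V (cone v x) = x - cone v (boundary V x) := by
  suffices boundary V ∘ₗ cone v = LinearMap.id - cone v ∘ₗ boundary V from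
    LinearMap.congr_fun this x
  ext1 s
  refine LinearMap.ext_ring ?_
  simp only [LinearMap.comp_apply, LinearMap.sub_apply, Finsupp.lsingle_apply, LinearMap.id_apply]
  rw [cone_single, boundary_single, one_smul, map_sum]
  simp only [cone_single, Finset.mem_erase]
  split_ifs with hv
  · rw [Finset.sum_eq_single v]
    · simp [Finset.insert_erase hv, vertexSign_erase_self, vertexSign_mul_self]
    · intro w _ hw
      rw [if_pos ⟨Ne.symm hw, hv⟩]
    · simp [hv]
  · rw [boundary_single, Finset.sum_insert hv, Finset.erase_insert hv, vertexSign_insert_self,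
      smul_add, Finsupp.smul_single, smul_eq_mul, one_mul, vertexSign_mul_self, sub_eq_add_neg,
      ← Finset.sum_neg_distrib, Finset.smul_sum]
    congr 1
    refine Finset.sum_congr rfl fun w hw => ?_
    have hvw : v ≠ w := fun h => hv (h ▸ hw)
    have h1 := vertexSign_mul (s := insert v s) (Finset.mem_insert_self v s)
      (Finset.mem_insert_of_mem hw) hvw
    rw [Finset.erase_insert hv, vertexSign_insert_self, Finset.erase_insert_of_ne hvw,
      vertexSign_insert_self] at h1
    rw [if_neg (fun h => hv h.2), Finset.erase_insert_of_ne hvw, Finsupp.smul_single, smul_eq_mul,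
      ← Finsupp.single_neg]
    congr 1
    have h2 := vertexSign_mul_self (insert v s) w
    have h3 := vertexSign_mul_self s v
    have h4 := vertexSign_mul_self (s.erase w) v
    set a := vertexSign s v
    set b := vertexSign s w
    set d := vertexSign (insert v s) w
    set f := vertexSign (s.erase w) v
    -- All four signs square to one, so `a * b = -(d * f)` is equivalent to the required `a * d =
    -- -(b * f)`.
    linear_combination (a * d ^ 2 * f) * h1 - b * f * (a ^ 2 * h2 + h3) - a * d * (d ^ 2 * h4 + h2)

end Family

/-! ### Homology of families of faces: cones and links -/

section Homology

variable {V : Type*} [LinearOrder V]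

/-- The `n`-chains of a family `F` of finite sets, a set of cardinality `n + 1` having
dimension `n`. -/
def familyChains (F : Set (Finset V)) (n : ℤ) : Submodule ℤ (Finset V →₀ ℤ) :=
  Finsupp.supported ℤ ℤ {s | s ∈ F ∧ (s.card : ℤ) = n + 1}

/-- The `n`-cycles of a family of finite sets. -/
def familyCycles (F : Set (Finset V)) (n : ℤ) : Submodule ℤ (Finset V →₀ ℤ) :=
  familyChains F n ⊓ LinearMap.ker (boundary V)

/-- The boundaries of the `(n + 1)`-chains, as a submodule of the `n`-cycles. -/
def familyBoundaries (F : Set (Finset V)) (n : ℤ) : Submodule ℤ (familyCycles F n) :=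
  ((familyChains F (n + 1)).map (boundary V)).submoduleOf (familyCycles F n)

/-- The homology of a family of finite sets that is closed under passing to subsets. -/
abbrev FamilyHomology (F : Set (Finset V)) (n : ℤ) : Type _ :=
  familyCycles F n ⧸ familyBoundaries F n

theorem mem_familyBoundaries {F : Set (Finset V)} {n : ℤ} {z : familyCycles F n} :
    z ∈ familyBoundaries F n ↔ ∃ x ∈ familyChains F (n + 1), boundary V x = z :=
  Iff.rfl

omit [LinearOrder V] in
theorem familyChains_mono {F G : Set (Finset V)} (h : F ⊆ G) (n : ℤ) :
    familyChains F n ≤ familyChains G n :=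
  Finsupp.supported_mono fun _ hs => ⟨h hs.1, hs.2⟩

theorem boundary_mem_familyChains {F : Set (Finset V)} (hF : IsLowerSet F) {n : ℤ}
    {x : Finset V →₀ ℤ} (hx : x ∈ familyChains F (n + 1)) : boundary V x ∈ familyChains F n := by
  refine map_supported_le (boundary V) (fun s hs => ?_) hx
  rw [boundary_single, one_smul]
  refine Submodule.sum_mem _ fun v hv => Finsupp.single_mem_supported ℤ _ ⟨?_, ?_⟩
  · exact hF (Finset.erase_subset v s) hs.1
  · have := Finset.card_erase_add_one hv
    have := hs.2
    omega

/-- The link of a vertex in a family of finite sets. -/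
def link (F : Set (Finset V)) (v : V) : Set (Finset V) := {s | v ∉ s ∧ insert v s ∈ F}

theorem cone_mem_familyChains {F G : Set (Finset V)} {v : V} (h : ∀ s ∈ F, insert v s ∈ G)
    {n : ℤ} {x : Finset V →₀ ℤ} (hx : x ∈ familyChains F n) :
    cone v x ∈ familyChains G (n + 1) := by
  refine map_supported_le (cone v) (fun s hs => ?_) hx
  rw [cone_single]
  split_ifs with hv
  · exact Submodule.zero_mem _
  · refine Finsupp.single_mem_supported ℤ _ ⟨h s hs.1, ?_⟩
    rw [Finset.card_insert_of_notMem hv]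
    have := hs.2
    push_cast
    omega

theorem contract_mem_familyChains {F : Set (Finset V)} (v : V)
    {n : ℤ} {x : Finset V →₀ ℤ} (hx : x ∈ familyChains F (n + 1)) :
    contract v x ∈ familyChains (link F v) n := by
  refine map_supported_le (contract v) (fun s hs => ?_) hx
  rw [contract_single]
  split_ifs with hv
  · refine Finsupp.single_mem_supported ℤ _ ⟨⟨by simp, ?_⟩, ?_⟩
    · rw [Finset.insert_erase hv]
      exact hs.1
    · have := Finset.card_erase_add_one hv
      have := hs.2
      omega
  · exact Submodule.zero_mem _

theorem contract_cone_self {F : Set (Finset V)} {v : V} (hF : ∀ s ∈ F, v ∉ s) {n : ℤ}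
    {x : Finset V →₀ ℤ} (hx : x ∈ familyChains F n) : contract v (cone v x) = x := by
  refine eqOn_supported (contract v ∘ₗ cone v) LinearMap.id (fun s hs => ?_) hx
  have hv := hF s hs.1
  simp [cone_single, contract_single, hv, vertexSign_insert_self, vertexSign_mul_self]

theorem contract_eq_zero {F : Set (Finset V)} {v : V} (hF : ∀ s ∈ F, v ∉ s) {n : ℤ}
    {x : Finset V →₀ ℤ} (hx : x ∈ familyChains F n) : contract v x = 0 := by
  refine eqOn_supported (contract v) 0 (fun s hs => ?_) hx
  simp [contract_single, hF s hs.1]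

/-- The homology of a cone vanishes: every cycle of `F` bounds in `G` if `G` contains the cone
over `F`. -/
theorem exists_boundary_eq_of_cone {F G : Set (Finset V)} {c : V}
    (hc : ∀ s ∈ F, insert c s ∈ G) {n : ℤ} {x : Finset V →₀ ℤ} (hx : x ∈ familyCycles F n) :
    ∃ y ∈ familyChains G (n + 1), boundary V y = x := by
  refine ⟨cone c x, cone_mem_familyChains hc hx.1, ?_⟩
  rw [boundary_cone, LinearMap.mem_ker.mp hx.2, map_zero, sub_zero]

theorem subsingleton_familyHomology_of_cone {F : Set (Finset V)} {c : V}
    (hc : ∀ s ∈ F, insert c s ∈ F) (n : ℤ) : Subsingleton (FamilyHomology F n) := by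
  rw [Submodule.Quotient.subsingleton_iff, eq_top_iff]
  exact fun z _ => mem_familyBoundaries.mpr (exists_boundary_eq_of_cone hc z.2)

/-- If no face of `F` has two vertices in the finite set `W`, and the faces without vertices in `W`
form a cone, then the homology of `F` is the sum of the shifted homologies of the links of the
elements of `W`. -/
theorem nonempty_familyHomology_equiv_pi_link {F : Set (Finset V)} (hF : IsLowerSet F) {W : Set V}
    [Finite W] (hW : ∀ s ∈ F, ∀ v ∈ W, ∀ w ∈ W, v ∈ s → w ∈ s → v = w) {c : V} (hcW : c ∉ W)
    (hc : ∀ s ∈ F, (∀ w ∈ W, w ∉ s) → insert c s ∈ F) (n : ℤ) :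
    Nonempty (FamilyHomology F (n + 1) ≃ₗ[ℤ] ((w : W) → FamilyHomology (link F w) n)) := by
  classical
  have := Fintype.ofFinite W
  set G : Set (Finset V) := {s | s ∈ F ∧ ∀ w ∈ W, w ∉ s} with hG
  have hGF : G ⊆ F := fun s hs => hs.1
  have hcG : ∀ s ∈ G, insert c s ∈ G := fun s hs => ⟨hc s hs.1 hs.2, fun w hw h => by
    rcases Finset.mem_insert.mp h with rfl | h
    · exact hcW hw
    · exact hs.2 w hw h⟩
  -- A chain lies in the cone part `G` as soon as all its contractions along `W` vanish.
  have mem_G : ∀ (m : ℤ) (x), x ∈ familyChains F m → (∀ w : W, contract (w : V) x = 0) →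
      x ∈ familyChains G m := by
    intro m x hx h s hs
    obtain ⟨hsF, hcard⟩ := hx hs
    refine ⟨⟨hsF, fun w hw hws => ?_⟩, hcard⟩
    have h1 := contract_apply_erase w hws x
    rw [h ⟨w, hw⟩, Finsupp.zero_apply] at h1
    have h2 := vertexSign_mul_self s w
    have h3 : x s = 0 := by linear_combination (-vertexSign s w) * h1 - x s * h2
    exact (Finsupp.mem_support_iff.mp hs) h3
  have cone_mem : ∀ (m : ℤ) (w : W) (x), x ∈ familyChains (link F (w : V)) m →
      cone (w : V) x ∈ familyChains F (m + 1) := fun m w x hx =>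
    cone_mem_familyChains (fun s hs => hs.2) hx
  have contract_cone : ∀ (m : ℤ) (v w : W) (x), x ∈ familyChains (link F (w : V)) m →
      contract (v : V) (cone (w : V) x) = if v = w then x else 0 := by
    intro m v w x hx
    split_ifs with h
    · subst h
      exact contract_cone_self (fun s hs => hs.1) hx
    -- All sets occurring in `cone w x` contain `w`, hence by `hW` no other element of `W`.
    · have hxw : cone (w : V) x ∈ familyChains {s | s ∈ F ∧ (w : V) ∈ s} (m + 1) :=
        cone_mem_familyChains (F := link F (w : V)) (G := {s | s ∈ F ∧ (w : V) ∈ s})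
          (fun s hs => ⟨hs.2, Finset.mem_insert_self _ _⟩) hx
      refine contract_eq_zero (fun s hs hv => h ?_) hxw
      exact Subtype.ext (hW s hs.1 v v.2 w w.2 hv hs.2)
  have contract_sum : ∀ (m : ℤ) (f : W → (Finset V →₀ ℤ)),
      (∀ w : W, f w ∈ familyChains (link F (w : V)) m) → ∀ v : W,
      contract (v : V) (∑ w : W, cone (w : V) (f w)) = f v := by
    intro m f hf v
    rw [map_sum, Finset.sum_congr rfl fun w _ => contract_cone m v w (f w) (hf w)]
    simp
  let φ : (w : W) → familyCycles F (n + 1) →ₗ[ℤ] familyCycles (link F (w : V)) n := fun w =>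
    (contract (w : V)).restrict fun x hx => ⟨contract_mem_familyChains _ hx.1, by
      change boundary V _ = 0
      rw [boundary_contract, LinearMap.mem_ker.mp hx.2, map_zero, neg_zero]⟩
  let Φ : familyCycles F (n + 1) →ₗ[ℤ] ((w : W) → FamilyHomology (link F (w : V)) n) :=
    LinearMap.pi fun w => (familyBoundaries _ n).mkQ ∘ₗ φ w
  have hsurj : Function.Surjective Φ := by
    intro q
    choose z hz using fun w => Submodule.mkQ_surjective _ (q w)
    -- This chain has the prescribed contractions but need not be a cycle. Its boundary has zero
    -- contractions because the `z w` are cycles, so it lies in `G` and can be filled there;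
    -- subtracting the filling leaves the contractions unchanged.
    set x := ∑ w : W, cone (w : V) (z w : Finset V →₀ ℤ) with hx
    have hxF : x ∈ familyChains F (n + 1) :=
      Submodule.sum_mem _ fun w _ => cone_mem n w _ (z w).2.1
    have hφx : ∀ v : W, contract (v : V) x = z v := contract_sum n _ fun w : W => (z w).2.1
    have hbG : boundary V x ∈ familyCycles G n := by
      refine ⟨mem_G n _ (boundary_mem_familyChains hF hxF) fun w => ?_, boundary_boundary x⟩
      rw [← neg_eq_zero, ← boundary_contract, hφx]
      exact (z w).2.2
    obtain ⟨y, hy, hyx⟩ := exists_boundary_eq_of_cone hcG hbG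
    refine ⟨⟨x - y, Submodule.sub_mem _ hxF (familyChains_mono hGF _ hy), ?_⟩, ?_⟩
    · change boundary V _ = 0
      rw [map_sub, hyx, sub_self]
    · funext w
      rw [← hz w]
      simp only [Φ, LinearMap.pi_apply, LinearMap.comp_apply]
      congr 1
      refine Subtype.ext ?_
      change contract (w : V) (x - y) = z w
      rw [map_sub, hφx, contract_eq_zero (fun s hs => hs.2 w w.2) hy, sub_zero]
  have hker : LinearMap.ker Φ = familyBoundaries F (n + 1) := by
    ext ⟨x, hx⟩
    have hmem : (⟨x, hx⟩ : familyCycles F (n + 1)) ∈ LinearMap.ker Φ ↔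
        ∀ w : W, ∃ y ∈ familyChains (link F (w : V)) (n + 1), boundary V y = contract (w : V) x := by
      rw [LinearMap.mem_ker, funext_iff]
      refine forall_congr' fun w => ?_
      exact (Submodule.Quotient.mk_eq_zero _).trans mem_familyBoundaries
    rw [hmem, mem_familyBoundaries]
    constructor
    · intro h
      choose y hy hyx using h
      -- Contraction anticommutes with the boundary, so adding `∂u` cancels every contraction of
      -- `x`. The resulting cycle lies in `G` and bounds there.
      set u := ∑ w : W, cone (w : V) (y w) with hu
      have huF : u ∈ familyChains F (n + 1 + 1) := Submodule.sum_mem _ fun w _ => cone_mem _ w _ (hy w)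
      have hφu : ∀ v : W, contract (v : V) u = y v := contract_sum _ _ hy
      have hG' : x + boundary V u ∈ familyCycles G (n + 1) := by
        refine ⟨mem_G _ _ (Submodule.add_mem _ hx.1 (boundary_mem_familyChains hF huF)) fun w => ?_, ?_⟩
        · rw [map_add, ← hyx, ← hφu, boundary_contract, neg_add_cancel]
        · change boundary V _ = 0
          rw [map_add, boundary_boundary, LinearMap.mem_ker.mp hx.2, add_zero]
      obtain ⟨t, ht, htx⟩ := exists_boundary_eq_of_cone hcG hG'
      refine ⟨t - u, Submodule.sub_mem _ (familyChains_mono hGF _ ht) huF, ?_⟩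
      rw [map_sub, htx, add_sub_cancel_right]
    · rintro ⟨y, hy, hyx⟩ w
      refine ⟨-contract (w : V) y, Submodule.neg_mem _ (contract_mem_familyChains _ hy), ?_⟩
      rw [map_neg, boundary_contract, hyx, neg_neg]
  exact ⟨(Submodule.quotEquivOfEq _ _ hker.symm).trans (Φ.quotKerEquivOfSurjective hsurj)⟩

/-- The family consisting of the empty set only has free homology. -/
theorem free_familyHomology_singleton_empty [Finite V] (n : ℤ) :
    Module.Free ℤ (FamilyHomology ({∅} : Set (Finset V)) n) := by
  -- As `∂[∅] = 0`, there are no boundaries, and the homology is a subgroup of a free abelian group.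
  have h : familyBoundaries ({∅} : Set (Finset V)) n = ⊥ := by
    rw [eq_bot_iff]
    intro z hz
    obtain ⟨x, hx, hxz⟩ := mem_familyBoundaries.mp hz
    have : boundary V x = 0 := eqOn_supported (boundary V) 0 (fun s hs => by
      obtain rfl : s = ∅ := hs.1
      simp [boundary_single]) hx
    rw [Submodule.mem_bot]
    exact Subtype.ext (hxz.symm.trans this)
  exact Module.Free.of_equiv (Submodule.quotEquivOfEqBot _ h).symm

/-- The homology of the family consisting of the empty set only is concentrated in
degree `-1`. -/
theorem subsingleton_familyHomology_singleton_empty {n : ℤ} (hn : n ≠ -1) :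
    Subsingleton (FamilyHomology ({∅} : Set (Finset V)) n) := by
  have : Subsingleton (familyCycles ({∅} : Set (Finset V)) n) := by
    refine ⟨fun x y => Subtype.ext ?_⟩
    have h : ∀ z ∈ familyCycles ({∅} : Set (Finset V)) n, z = 0 := fun z hz => by
      refine eqOn_supported LinearMap.id 0 (fun s hs => ?_) hz.1
      obtain ⟨rfl, h⟩ := hs
      simp at h
      omega
    rw [h x x.2, h y y.2]
  infer_instance

end Homology

/-! ### Change of vertex set and of vertex order -/

section Relabel

variable {V : Type u} {U : Type*} [LinearOrder V] [LinearOrder U]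

/-- The sign of the permutation by which `f` changes the order of the elements of `s`. -/
def relabelSign (f : V ↪ U) (s : Finset V) : ℤ :=
  ∏ a ∈ s, ∏ b ∈ s, if a < b ∧ f b < f a then -1 else 1

/-- The map that a renaming of the vertices induces on chains. -/
def relabel (f : V ↪ U) : (Finset V →₀ ℤ) →ₗ[ℤ] (Finset U →₀ ℤ) :=
  Finsupp.linearCombination ℤ fun s => Finsupp.single (s.map f) (relabelSign f s)

theorem relabel_single (f : V ↪ U) (s : Finset V) (c : ℤ) :
    relabel f (Finsupp.single s c) = Finsupp.single (s.map f) (c * relabelSign f s) := by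
  simp [relabel]

theorem relabelSign_mul_self (f : V ↪ U) (s : Finset V) :
    relabelSign f s * relabelSign f s = 1 := by
  simp only [relabelSign, ← Finset.prod_mul_distrib]
  refine Finset.prod_eq_one fun a _ => Finset.prod_eq_one fun b _ => ?_
  split_ifs <;> norm_num

theorem vertexSign_eq_prod (s : Finset V) (v : V) :
    vertexSign s v = ∏ w ∈ s.erase v, if w < v then -1 else 1 := by
  rw [← vertexSign_erase_self, vertexSign, Finset.prod_ite]
  simp

/-- Removing `v` from `s` discards the inversions involving `v`. An element `w` gives such an
inversion exactly when it changes sides relative to `v`, which is also when its contributions to the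
two vertex signs differ. -/
theorem relabelSign_mul_vertexSign (f : V ↪ U) {s : Finset V} {v : V} (hv : v ∈ s) :
    relabelSign f s * vertexSign (s.map f) (f v)
      = vertexSign s v * relabelSign f (s.erase v) := by
  have h1 : vertexSign (s.map f) (f v) = ∏ w ∈ s.erase v, if f w < f v then -1 else 1 := by
    rw [vertexSign_eq_prod, ← Finset.map_erase, Finset.prod_map]
  have h2 : relabelSign f s
      = (∏ w ∈ s.erase v, (if v < w ∧ f w < f v then -1 else 1) *
          (if w < v ∧ f v < f w then -1 else 1)) * relabelSign f (s.erase v) := by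
    unfold relabelSign
    rw [← Finset.mul_prod_erase s _ hv, ← Finset.mul_prod_erase s _ hv]
    rw [if_neg (fun h => lt_irrefl _ h.1), one_mul]
    rw [Finset.prod_congr rfl fun a _ => (Finset.mul_prod_erase s _ hv).symm]
    rw [Finset.prod_mul_distrib, Finset.prod_mul_distrib, mul_assoc]
  rw [h1, h2, vertexSign_eq_prod, mul_right_comm, ← Finset.prod_mul_distrib]
  congr 1
  refine Finset.prod_congr rfl fun w hw => ?_
  have hwv := Finset.ne_of_mem_erase hw
  have hf : f w ≠ f v := fun h => hwv (f.injective h)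
  rcases lt_or_gt_of_ne hwv with h | h <;> rcases lt_or_gt_of_ne hf with h' | h' <;>
    simp [h, h', h.not_gt, h'.not_gt]

theorem boundary_relabel (f : V ↪ U) (x : Finset V →₀ ℤ) :
    boundary U (relabel f x) = relabel f (boundary V x) := by
  suffices boundary U ∘ₗ relabel f = relabel f ∘ₗ boundary V from LinearMap.congr_fun this x
  ext1 s
  refine LinearMap.ext_ring ?_
  simp only [LinearMap.comp_apply, Finsupp.lsingle_apply]
  rw [relabel_single, boundary_single, boundary_single, one_mul, one_smul, map_sum,
    Finset.smul_sum, Finset.sum_map]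
  refine Finset.sum_congr rfl fun v hv => ?_
  rw [relabel_single, Finsupp.smul_single, smul_eq_mul, relabelSign_mul_vertexSign f hv,
    Finset.map_erase]

theorem relabel_apply_map (f : V ↪ U) (x : Finset V →₀ ℤ) (s : Finset V) :
    relabel f x (s.map f) = relabelSign f s * x s := by
  induction x using Finsupp.induction_linear with
  | zero => simp
  | add g h hg hh => simp [hg, hh, mul_add]
  | single t c =>
    rw [relabel_single]
    by_cases ht : t = s
    · subst ht
      simp [mul_comm]
    · rw [Finsupp.single_eq_of_ne (Ne.symm ht), Finsupp.single_eq_of_ne, mul_zero]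
      exact fun h => ht (Finset.map_injective f h.symm)

theorem relabel_injective (f : V ↪ U) : Function.Injective (relabel f) := by
  rw [injective_iff_map_eq_zero]
  intro x hx
  ext s
  have h1 := relabel_apply_map f x s
  rw [hx, Finsupp.zero_apply] at h1
  have h2 := relabelSign_mul_self f s
  rw [Finsupp.zero_apply]
  linear_combination (-relabelSign f s) * h1 - x s * h2

/-- The images of the simplices of `K`, including the empty one, under an embedding of the
vertex set. -/
def imageFamily (K : PreAbstractSimplicialComplex V) (f : V ↪ U) : Set (Finset U) :=
  {t | ∃ s, (s = ∅ ∨ s ∈ K) ∧ s.map f = t}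

theorem relabel_mem_familyChains (K : PreAbstractSimplicialComplex V) (f : V ↪ U) {n : ℤ}
    {x : Finset V →₀ ℤ} (hx : x ∈ chains K n) :
    relabel f x ∈ familyChains (imageFamily K f) n := by
  refine map_supported_le (relabel f) (fun s hs => ?_) hx
  rw [relabel_single]
  exact Finsupp.single_mem_supported ℤ _ ⟨⟨s, hs.1, rfl⟩, by rw [Finset.card_map]; exact hs.2⟩

theorem exists_relabel_eq (K : PreAbstractSimplicialComplex V) (f : V ↪ U) {n : ℤ}
    {y : Finset U →₀ ℤ} (hy : y ∈ familyChains (imageFamily K f) n) :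
    ∃ x ∈ chains K n, relabel f x = y := by
  suffices familyChains (imageFamily K f) n ≤ (chains K n).map (relabel f) from this hy
  rw [familyChains, Finsupp.supported_eq_span_single, Submodule.span_le]
  rintro _ ⟨_, ⟨⟨s, hs, rfl⟩, hcard⟩, rfl⟩
  rw [Finset.card_map] at hcard
  refine ⟨Finsupp.single s (relabelSign f s), Finsupp.single_mem_supported ℤ _ ⟨hs, hcard⟩, ?_⟩
  rw [relabel_single, relabelSign_mul_self]

-- The differential is defined by cases on the degrees; evaluating it at `n + 1`, `n`, `n - 1` turns
-- categorical homology into kernel modulo image.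
open CategoryTheory in
theorem nonempty_augmentedChainComplex_homology_equiv (K : PreAbstractSimplicialComplex V) (n : ℤ)
    (h : chainBoundary K (sub_add_cancel n 1) ∘ₗ chainBoundary K (rfl : n + 1 = n + 1) = 0) :
    Nonempty ((augmentedChainComplex K).homology n ≃ₗ[ℤ]
      (LinearMap.ker (chainBoundary K (sub_add_cancel n 1)) ⧸
        LinearMap.range ((chainBoundary K (rfl : n + 1 = n + 1)).codRestrict
          (LinearMap.ker (chainBoundary K (sub_add_cancel n 1)))
          fun x => LinearMap.congr_fun h x))) := by
  have hprev : (ComplexShape.down ℤ).prev n = n + 1 := (ComplexShape.down ℤ).prev_eq' rfl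
  have hnext : (ComplexShape.down ℤ).next n = n - 1 :=
    (ComplexShape.down ℤ).next_eq' (sub_add_cancel n 1)
  have hd : ∀ {i j : ℤ} (hij : j + 1 = i),
      (augmentedChainComplex K).d i j = ModuleCat.ofHom (chainBoundary K hij) :=
    fun hij => dif_pos hij
  have hS : (augmentedChainComplex K).sc' (n + 1) n (n - 1) = ShortComplex.moduleCatMk _ _ h := by
    change ShortComplex.mk ((augmentedChainComplex K).d (n + 1) n)
      ((augmentedChainComplex K).d n (n - 1)) _ = ShortComplex.mk _ _ _
    congr 1
    · exact hd rfl
    · exact hd (sub_add_cancel n 1)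
  exact ⟨(((augmentedChainComplex K).homologyIsoSc' (n + 1) n (n - 1) hprev hnext) ≪≫
    ShortComplex.homologyMapIso (eqToIso hS) ≪≫
      (ShortComplex.moduleCatMk _ _ h).moduleCatHomologyIso).toLinearEquiv⟩

/-- With its signs, `relabel f` commutes with the boundary and is bijective from the chains of `K`
onto those of the image, so it identifies cycles and boundaries. -/
theorem nonempty_homology_equiv_familyHomology (K : PreAbstractSimplicialComplex V) (f : V ↪ U)
    (n : ℤ) :
    Nonempty ((augmentedChainComplex K).homology n ≃ₗ[ℤ] FamilyHomology (imageFamily K f) n) := by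
  set g := chainBoundary K (sub_add_cancel n 1)
  set d := chainBoundary K (rfl : n + 1 = n + 1)
  have hgd : g ∘ₗ d = 0 := by
    ext1 x
    exact Subtype.ext (boundary_boundary (x : Finset V →₀ ℤ))
  obtain ⟨e₁⟩ := nonempty_augmentedChainComplex_homology_equiv K n hgd
  have hg : ∀ x : chains K n, g x = 0 ↔ boundary V x = 0 := fun x => Subtype.ext_iff
  let ρ : LinearMap.ker g →ₗ[ℤ] familyCycles (imageFamily K f) n :=
    LinearMap.codRestrict _ (relabel f ∘ₗ (chains K n).subtype ∘ₗ (LinearMap.ker g).subtype)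
      fun x => ⟨relabel_mem_familyChains K f x.1.2, by
        change boundary U (relabel f x.1.1) = 0
        rw [boundary_relabel, (hg x.1).mp x.2, map_zero]⟩
  let Ψ := (familyBoundaries (imageFamily K f) n).mkQ ∘ₗ ρ
  have hsurj : Function.Surjective Ψ := by
    refine (Submodule.mkQ_surjective _).comp fun y => ?_
    obtain ⟨x, hx, hxy⟩ := exists_relabel_eq K f y.2.1
    refine ⟨⟨⟨x, hx⟩, (hg ⟨x, hx⟩).mpr (relabel_injective f ?_)⟩, Subtype.ext hxy⟩
    rw [← boundary_relabel, hxy, map_zero]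
    exact y.2.2
  have hker : LinearMap.ker Ψ = LinearMap.range
      (d.codRestrict (LinearMap.ker g) fun x => LinearMap.congr_fun hgd x) := by
    ext z
    have h1 : z ∈ LinearMap.ker Ψ ↔ ∃ y ∈ familyChains (imageFamily K f) (n + 1),
        boundary U y = relabel f (z : chains K n) :=
      (Submodule.Quotient.mk_eq_zero _).trans mem_familyBoundaries
    rw [h1]
    constructor
    · rintro ⟨y, hy, hyz⟩
      obtain ⟨x, hx, rfl⟩ := exists_relabel_eq K f hy
      rw [boundary_relabel] at hyz
      exact ⟨(⟨x, hx⟩ : chains K (n + 1)),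
        Subtype.ext (Subtype.ext (relabel_injective f hyz))⟩
    · rintro ⟨x, rfl⟩
      exact ⟨relabel f x, relabel_mem_familyChains K f x.2, boundary_relabel f _⟩
  exact ⟨e₁.trans ((Submodule.quotEquivOfEq _ _ hker.symm).trans
    (Ψ.quotKerEquivOfSurjective hsurj))⟩

end Relabel

theorem nonempty_reducedHomology_equiv {V : Type u} {U : Type*} [LinearOrder U]
    (K : PreAbstractSimplicialComplex V) (f : V ↪ U) (n : ℤ) :
    Nonempty (reducedHomology K n ≃ₗ[ℤ] FamilyHomology (imageFamily K f) n) := by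
  let _ : LinearOrder V :=
    haveI := Classical.decRel (WellOrderingRel (α := V))
    linearOrderOfSTO (WellOrderingRel (α := V))
  exact nonempty_homology_equiv_familyHomology K f n

/-! ### Clique complexes of the relation `x * y = 0` -/

section Clique

variable {A : Type*} [CommRing A]

/-- The finite subsets of `S` in which any two distinct elements have product zero. -/
def cliqueFamily (S : Set A) : Set (Finset A) :=
  {s | (s : Set A) ⊆ S ∧ (s : Set A).Pairwise fun x y => x * y = 0}

theorem isLowerSet_cliqueFamily (S : Set A) : IsLowerSet (cliqueFamily S) := fun _ _ hts hs =>
  ⟨(Finset.coe_subset.mpr hts).trans hs.1, hs.2.mono (Finset.coe_subset.mpr hts)⟩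

theorem cliqueFamily_empty : cliqueFamily (∅ : Set A) = {∅} := by
  ext s
  constructor
  · exact fun hs => Finset.coe_eq_empty.mp (Set.subset_empty_iff.mp hs.1)
  · rintro rfl
    simp [cliqueFamily]

variable [LinearOrder A]

theorem insert_mem_cliqueFamily {S : Set A} {a : A} {s : Finset A} (hs : s ∈ cliqueFamily S)
    (ha : a ∈ S) (h : ∀ z ∈ s, z ≠ a → a * z = 0) : insert a s ∈ cliqueFamily S := by
  refine ⟨?_, ?_⟩
  · rw [Finset.coe_insert]
    exact Set.insert_subset ha hs.1
  · rw [Finset.coe_insert]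
    refine hs.2.insert fun z hz hza => ?_
    have := h z hz hza.symm
    exact ⟨this, by rw [mul_comm]; exact this⟩

theorem link_cliqueFamily {S : Set A} {w : A} (hw : w ∈ S) :
    link (cliqueFamily S) w = cliqueFamily {z | z ∈ S ∧ z ≠ w ∧ w * z = 0} := by
  ext s
  constructor
  · rintro ⟨hws, h1, h2⟩
    rw [Finset.coe_insert] at h1 h2
    refine ⟨fun z hz => ?_, h2.mono (Set.subset_insert _ _)⟩
    have hzw : z ≠ w := fun h => hws (h ▸ hz)
    exact ⟨h1 (Set.mem_insert_of_mem _ hz), hzw,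
      h2 (Set.mem_insert _ _) (Set.mem_insert_of_mem _ hz) hzw.symm⟩
  · intro hs
    refine ⟨fun h => (hs.1 h).2.1 rfl, insert_mem_cliqueFamily ⟨fun z hz => (hs.1 hz).1, hs.2⟩ hw
      fun z hz _ => (hs.1 hz).2.2⟩

theorem nonempty_familyHomology_cliqueFamily_equiv {S W : Set A} [Finite W] (hWS : W ⊆ S)
    (hW : W.Pairwise fun x y => x * y ≠ 0) {c : A} (hcS : c ∈ S) (hcW : c ∉ W)
    (hc : ∀ z ∈ S, z ∉ W → z ≠ c → c * z = 0) (n : ℤ) :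
    Nonempty (FamilyHomology (cliqueFamily S) (n + 1) ≃ₗ[ℤ]
      ((w : W) → FamilyHomology (cliqueFamily {z | z ∈ S ∧ z ≠ w ∧ (w : A) * z = 0}) n)) := by
  obtain ⟨e⟩ := nonempty_familyHomology_equiv_pi_link (isLowerSet_cliqueFamily S) (W := W)
    (fun s hs v hv w hw hvs hws => by
      by_contra hne
      exact hW hv hw hne (hs.2 hvs hws hne)) hcW
    (fun s hs h => insert_mem_cliqueFamily hs hcS fun z hz hzc =>
      hc z (hs.1 hz) (fun hzW => h z hzW hz) hzc) n
  have h : ∀ w : W, link (cliqueFamily S) (w : A)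
      = cliqueFamily {z | z ∈ S ∧ z ≠ w ∧ (w : A) * z = 0} := fun w => link_cliqueFamily (hWS w.2)
  exact ⟨e.trans (LinearEquiv.piCongrRight fun w => by rw [h w]; exact LinearEquiv.refl ℤ _)⟩

/-- This serves both `K` and `K₀`. Only vanishing of products matters, so `f` need not come from a
unital ring homomorphism; extension by zero is allowed. -/
theorem nonempty_reducedHomology_cliqueComplex_equiv {B : Type u} [CommRing B] {S : Set B}
    (f : S ↪ A) (hf : ∀ x y : S, f x * f y = 0 ↔ (x : B) * y = 0) (n : ℤ) :
    Nonempty (reducedHomology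
      (cliqueComplex ((annihilationGraph B).induce S)).toPreAbstractSimplicialComplex n ≃ₗ[ℤ]
      FamilyHomology (cliqueFamily (Set.range f)) n) := by
  obtain ⟨e⟩ := nonempty_reducedHomology_equiv
    (cliqueComplex ((annihilationGraph B).induce S)).toPreAbstractSimplicialComplex f n
  suffices h : imageFamily
      (cliqueComplex ((annihilationGraph B).induce S)).toPreAbstractSimplicialComplex f
      = cliqueFamily (Set.range f) by
    rw [h] at e
    exact ⟨e⟩
  have key : ∀ s : Finset S, (s : Set S).Pairwise (fun x y => (x : B) * y = 0) ↔
      ((annihilationGraph B).induce S).IsClique (s : Set S) := fun s =>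
    ⟨fun h x hx y hy hxy => ⟨fun h' => hxy (Subtype.ext h'), h hx hy hxy⟩,
      fun h x hx y hy hxy => (h hx hy hxy).2⟩
  ext t
  constructor
  · rintro ⟨s, hs, rfl⟩
    have hs' : (s : Set S).Pairwise fun x y => (x : B) * y = 0 := by
      rcases hs with rfl | hs
      · simp
      · exact (key s).mpr hs.2
    rw [cliqueFamily, Set.mem_ofPred_eq, Finset.coe_map]
    refine ⟨Set.image_subset_range _ _, ?_⟩
    rintro _ ⟨x, hx, rfl⟩ _ ⟨y, hy, rfl⟩ hxy
    exact (hf x y).mpr (hs' hx hy fun h => hxy (h ▸ rfl))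
  · rintro ⟨h1, h2⟩
    rw [← Set.image_univ] at h1
    obtain ⟨s, -, rfl⟩ := Finset.subset_set_image_iff.mp h1
    refine ⟨s, ?_, by rw [Finset.map_eq_image]⟩
    rcases s.eq_empty_or_nonempty with rfl | hne
    · exact Or.inl rfl
    · refine Or.inr ⟨hne, (key s).mp fun x hx y hy hxy => (hf x y).mp (h2 ?_ ?_ ?_)⟩
      · exact Finset.mem_image_of_mem _ hx
      · exact Finset.mem_image_of_mem _ hy
      · exact fun h => hxy (f.injective h)

end Clique

/-- A nonzero finite ring has an associated prime, the annihilator of some `x`. Primes of an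
Artinian ring are maximal, so in the local case this annihilator consists of all nonunits. -/
theorem exists_ne_zero_mul_eq_zero_of_not_isUnit (B : Type*) [CommRing B] [Finite B]
    [IsLocalRing B] : ∃ s : B, s ≠ 0 ∧ ∀ y, ¬ IsUnit y → s * y = 0 := by
  obtain ⟨p, hp⟩ := associatedPrimes.nonempty B B
  obtain ⟨hprime, x, rfl⟩ := isAssociatedPrime_iff.mp hp
  have hmax := IsLocalRing.eq_maximalIdeal 
    (IsArtinianRing.isMaximal_of_isPrime ((⊥ : Submodule B B).colon {x}))
  refine ⟨x, ?_, fun y hy => ?_⟩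
  · rintro rfl
    exact hprime.ne_top (by simp)
  · have : y ∈ (⊥ : Submodule B B).colon {x} := by
      rw [hmax]
      exact hy
    rw [Submodule.mem_colon_singleton] at this
    rw [mul_comm]
    simpa using this

/-- Factors of a product that are subsingletons can be omitted. -/
def piEquivPiSubtype {ι : Type*} (p : ι → Prop) (M : ι → Type*) [∀ i, AddCommGroup (M i)]
    (h : ∀ i, ¬ p i → Subsingleton (M i)) : ((i : ι) → M i) ≃ₗ[ℤ] ((i : {i // p i}) → M i) := by
  classical
  refine LinearEquiv.ofBijective (LinearMap.pi fun i => LinearMap.proj i.1) ⟨?_, ?_⟩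
  · intro f g hfg
    funext i
    by_cases hi : p i
    · exact congrFun hfg ⟨i, hi⟩
    · exact (h i hi).elim _ _
  · intro f
    refine ⟨fun i => if hi : p i then f ⟨i, hi⟩ else 0, ?_⟩
    funext i
    simp [i.2]

/-! ### The decomposition for products of finite local rings -/

section Product

variable {ι : Type*} [Fintype ι] [DecidableEq ι] {R : ι → Type*} [∀ i, CommRing (R i)]

/-- The nonzero elements of the product of the `R i` with support in `J`. -/
def supportedOn (R : ι → Type*) [∀ i, CommRing (R i)] (J : Finset ι) : Set ((i : ι) → R i) :=
  {z | z ≠ 0 ∧ ∀ i ∉ J, z i = 0}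

open Classical in
/-- The indices in `J` at which `w` vanishes. -/
def zerosIn (J : Finset ι) (w : (i : ι) → R i) : Finset ι := J.filter fun i => w i = 0

variable [∀ i, Finite (R i)] [∀ i, IsLocalRing (R i)] [LinearOrder ((i : ι) → R i)]

/-- The vertex set `S` is left flexible for two uses: all nonzero elements supported on `J`, for
freeness, and the nonzero nonunits of the whole product, for `K(Ω)`. -/
theorem nonempty_familyHomology_product_equiv {J : Finset ι} {k : ι} (hk : k ∈ J)
    {S : Set ((i : ι) → R i)} (hSJ : S ⊆ supportedOn R J)
    (hS : ∀ z ∈ supportedOn R J, ¬ IsUnit (z k) → z ∈ S) {s : R k}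
    (hs : ∀ y, ¬ IsUnit y → s * y = 0) (hc : Pi.single k s ∈ S) (n : ℤ) :
    Nonempty (FamilyHomology (cliqueFamily S) (n + 1) ≃ₗ[ℤ]
      ((w : {w | w ∈ S ∧ IsUnit (w k) ∧ w ≠ Pi.single k s ∧ ∀ i, w i = 0 ∨ IsUnit (w i)}) →
        FamilyHomology (cliqueFamily (supportedOn R (zerosIn J w.1))) n)) := by
  set c : (i : ι) → R i := Pi.single k s with hcdef
  set W : Set ((i : ι) → R i) := {w | w ∈ S ∧ IsUnit (w k) ∧ w ≠ c} with hWdef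
  obtain ⟨e⟩ := nonempty_familyHomology_cliqueFamily_equiv (S := S) (W := W) (fun w hw => hw.1)
    (fun x hx y hy _ hxy => (hx.2.1.mul hy.2.1).ne_zero (congrFun hxy k)) hc (fun h => h.2.2 rfl)
    (fun z hz hzW hzc => by
      have hzk : ¬ IsUnit (z k) := fun h => hzW ⟨hz, h, hzc⟩
      funext i
      by_cases hi : i = k
      · subst hi
        simpa [hcdef] using hs _ hzk
      · simp [hcdef, hi]) n
  have hlink : ∀ w : W, (∀ i, w.1 i = 0 ∨ IsUnit (w.1 i)) →
      {z | z ∈ S ∧ z ≠ w ∧ (w : (i : ι) → R i) * z = 0} = supportedOn R (zerosIn J w.1) := by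
    rintro ⟨w, hwS, hwk, hwc⟩ hw
    ext z
    constructor
    · rintro ⟨hzS, -, hwz⟩
      refine ⟨(hSJ hzS).1, fun i hi => ?_⟩
      by_cases hiJ : i ∈ J
      · have hwi : w i ≠ 0 := fun h => hi (by simp [zerosIn, hiJ, h])
        exact ((hw i).resolve_left hwi).mul_right_eq_zero.mp (congrFun hwz i)
      · exact (hSJ hzS).2 i hiJ
    · rintro ⟨hz0, hz⟩
      have hzk : z k = 0 := hz k (by simp [zerosIn, hwk.ne_zero])
      refine ⟨hS z ⟨hz0, fun i hi => hz i (by simp [zerosIn, hi])⟩ (by simp [hzk]), ?_, ?_⟩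
      · rintro rfl
        exact hwk.ne_zero hzk
      · funext i
        by_cases hwi : w i = 0
        · simp [hwi]
        · simp [hz i (by simp [zerosIn, hwi])]
  -- Suppose `w i` is neither zero nor a unit, and let `t ≠ 0` in `R i` kill all nonunits. Each `z`
  -- in the link has `z i * w i = 0` with `w i ≠ 0`, so `z i` is a nonunit. Hence `Pi.single i t`
  -- kills `w` and the whole link, and is an apex for it.
  have hzero : ∀ w : W, ¬ (∀ i, w.1 i = 0 ∨ IsUnit (w.1 i)) →
      Subsingleton (FamilyHomology
        (cliqueFamily {z | z ∈ S ∧ z ≠ w ∧ (w : (i : ι) → R i) * z = 0}) n) := by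
    rintro ⟨w, hwS, hwk, hwc⟩ hw
    obtain ⟨i, hi0, hiu⟩ : ∃ i, w i ≠ 0 ∧ ¬ IsUnit (w i) := by
      simpa using hw
    obtain ⟨t, ht0, ht⟩ := exists_ne_zero_mul_eq_zero_of_not_isUnit (R i)
    have hik : k ≠ i := fun h => by subst h; exact hiu hwk
    have hiJ : i ∈ J := by
      by_contra h
      exact hi0 ((hSJ hwS).2 i h)
    have hak : (Pi.single i t : (i : ι) → R i) k = 0 := by simp [hik]
    have hmul : ∀ z : (i : ι) → R i, ¬ IsUnit (z i) → Pi.single i t * z = 0 := by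
      intro z hz
      rw [← Pi.single_mul_left, ht _ hz, Pi.single_zero]
    refine subsingleton_familyHomology_of_cone (c := Pi.single i t) (fun s hs => ?_) n
    refine insert_mem_cliqueFamily hs ⟨hS _ ⟨by simpa using ht0, fun j hj => ?_⟩ ?_, ?_, ?_⟩
      fun z hz _ => hmul z fun hu => ?_
    · exact Pi.single_eq_of_ne (fun h => by subst h; exact hj hiJ) _
    · rw [hak]
      exact not_isUnit_zero
    · exact fun h => hwk.ne_zero ((congrFun h k).symm.trans hak)
    · rw [mul_comm]
      exact hmul w hiu
    · exact hi0 (hu.mul_left_eq_zero.mp (congrFun (hs.1 hz).2.2 i))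
  let e' := e.trans (piEquivPiSubtype (fun w : W => ∀ i, w.1 i = 0 ∨ IsUnit (w.1 i)) _ hzero)
  let σ : {w | w ∈ S ∧ IsUnit (w k) ∧ w ≠ c ∧ ∀ i, w i = 0 ∨ IsUnit (w i)} ≃
      {w : W // ∀ i, w.1 i = 0 ∨ IsUnit (w.1 i)} :=
    { toFun := fun w => ⟨⟨w.1, w.2.1, w.2.2.1, w.2.2.2.1⟩, w.2.2.2.2⟩
      invFun := fun w => ⟨w.1.1, w.1.2.1, w.1.2.2.1, w.1.2.2.2, w.2⟩
      left_inv := fun _ => rfl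
      right_inv := fun _ => rfl }
  refine ⟨e'.trans (((LinearEquiv.piCongrLeft ℤ _ σ).symm).trans
    (LinearEquiv.piCongrRight fun w => ?_))⟩
  rw [hlink (σ w).1 (σ w).2]
  exact LinearEquiv.refl _ _

theorem free_familyHomology_supportedOn (J : Finset ι) (n : ℤ) :
    Module.Free ℤ (FamilyHomology (cliqueFamily (supportedOn R J)) n) := by
  induction J using Finset.strongInduction generalizing n with
  | H J ih =>
    rcases J.eq_empty_or_nonempty with rfl | ⟨k, hk⟩
    · have : supportedOn R ∅ = ∅ := by
        ext z
        simp only [supportedOn, Set.mem_ofPred_eq, Set.mem_empty_iff_false, iff_false, not_and]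
        exact fun hz h => hz (funext fun i => h i (Finset.notMem_empty i))
      rw [this, cliqueFamily_empty]
      exact free_familyHomology_singleton_empty n
    · classical
      obtain ⟨s, hs0, hs⟩ := exists_ne_zero_mul_eq_zero_of_not_isUnit (R k)
      obtain ⟨m, rfl⟩ : ∃ m, n = m + 1 := ⟨n - 1, by ring⟩
      obtain ⟨e⟩ := nonempty_familyHomology_product_equiv hk (S := supportedOn R J) subset_rfl
        (fun z hz _ => hz) hs ⟨by simpa using hs0, fun i hi =>
          Pi.single_eq_of_ne (fun h => by subst h; exact hi hk) _⟩ m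
      -- Since `w k` is a unit and `k ∈ J`, the zero set of `w` in `J` is strictly smaller than `J`.
      have hfree := fun w : {w | w ∈ supportedOn R J ∧ IsUnit (w k) ∧ w ≠ Pi.single k s ∧
          ∀ i, w i = 0 ∨ IsUnit (w i)} =>
        ih (zerosIn J w.1) (Finset.filter_ssubset.mpr ⟨k, hk, w.2.2.1.ne_zero⟩) m
      exact Module.Free.of_equiv e.symm

end Product

theorem nonempty_pi_equiv_pi_of_card_fiber {W ι : Type*} [Finite W] (M : W → Type*)
    [∀ w, AddCommGroup (M w)] (H : ι → Type*) [∀ i, AddCommGroup (H i)] (q : W → ι) (m : ι → ℕ)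
    (hcard : ∀ i, Nat.card {w // q w = i} = m i)
    (hM : ∀ w i, q w = i → Nonempty (M w ≃ₗ[ℤ] H i)) :
    Nonempty (((w : W) → M w) ≃ₗ[ℤ] ((i : ι) → Fin (m i) → H i)) := by
  let τ : (Σ i, Fin (m i)) ≃ W :=
    (Equiv.sigmaCongrRight fun i => (Finite.equivFinOfCardEq (hcard i)).symm).trans
      (Equiv.sigmaFiberEquiv q)
  have hτ : ∀ p, q (τ p) = p.1 := fun p => ((Finite.equivFinOfCardEq (hcard p.1)).symm p.2).2
  let e := fun p => (hM (τ p) p.1 (hτ p)).some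
  exact ⟨(LinearEquiv.piCongrLeft ℤ M τ).symm.trans ((LinearEquiv.piCongrRight e).trans
    (LinearEquiv.piCurry ℤ fun i (_ : Fin (m i)) => H i))⟩

/-! ### Partial products embedded by zero, and `K(Ω)` inside the product -/

section Extension

variable {ι κ : Type*} [Fintype κ] [DecidableEq ι] {R : ι → Type u} [∀ i, CommRing (R i)]

/-- Extension by zero along an injective map of index sets. -/
def extendByZero (g : κ ↪ ι) (x : (j : κ) → R (g j)) : (i : ι) → R i :=
  ∑ j, Pi.single (g j) (x j)

theorem extendByZero_apply (g : κ ↪ ι) (x : (j : κ) → R (g j)) (j : κ) :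
    extendByZero g x (g j) = x j := by
  rw [extendByZero, Finset.sum_apply, Finset.sum_eq_single j]
  · simp
  · exact fun l _ hl => Pi.single_eq_of_ne (fun h => hl (g.injective h.symm)) _
  · simp

theorem extendByZero_apply_of_notMem (g : κ ↪ ι) (x : (j : κ) → R (g j)) {i : ι}
    (hi : ∀ j, g j ≠ i) : extendByZero g x i = 0 := by
  rw [extendByZero, Finset.sum_apply]
  exact Finset.sum_eq_zero fun j _ => Pi.single_eq_of_ne (hi j).symm _

theorem extendByZero_injective (g : κ ↪ ι) :
    Function.Injective (extendByZero g : ((j : κ) → R (g j)) → (i : ι) → R i) := by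
  intro x y h
  funext j
  rw [← extendByZero_apply g x j, h, extendByZero_apply]

theorem extendByZero_mul_eq_zero_iff (g : κ ↪ ι) (x y : (j : κ) → R (g j)) :
    extendByZero g x * extendByZero g y = 0 ↔ x * y = 0 := by
  constructor
  · intro h
    funext j
    have := congrFun h (g j)
    rwa [Pi.mul_apply, extendByZero_apply, extendByZero_apply] at this
  · intro h
    funext i
    by_cases hi : ∃ j, g j = i
    · obtain ⟨j, rfl⟩ := hi
      rw [Pi.mul_apply, extendByZero_apply, extendByZero_apply]
      exact congrFun h j
    · push Not at hi
      simp [extendByZero_apply_of_notMem g x hi]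

theorem nonempty_reducedHomology_K₀_equiv [LinearOrder ((i : ι) → R i)] (g : κ ↪ ι) (J : Finset ι)
    (hJ : ∀ i, i ∈ J ↔ ∃ j, g j = i) (n : ℤ) :
    Nonempty (reducedHomology (K₀ ((j : κ) → R (g j))) n ≃ₗ[ℤ]
      FamilyHomology (cliqueFamily (supportedOn R J)) n) := by
  let f : {x : (j : κ) → R (g j) | x ≠ 0} ↪ ((i : ι) → R i) :=
    ⟨fun x => extendByZero g x, (extendByZero_injective g).comp Subtype.val_injective⟩
  obtain ⟨e⟩ := nonempty_reducedHomology_cliqueComplex_equiv f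
    (fun x y => extendByZero_mul_eq_zero_iff g x.1 y.1) n
  have hrange : Set.range f = supportedOn R J := by
    ext z
    constructor
    · rintro ⟨⟨x, hx⟩, rfl⟩
      refine ⟨fun h => hx ?_, fun i hi => extendByZero_apply_of_notMem g x fun j hj => ?_⟩
      · funext j
        rw [← extendByZero_apply g x j]
        exact congrFun h (g j)
      · exact hi ((hJ i).mpr ⟨j, hj⟩)
    · rintro ⟨hz0, hz⟩
      have hzx : extendByZero g (fun j => z (g j)) = z := by
        funext i
        by_cases hi : ∃ j, g j = i
        · obtain ⟨j, rfl⟩ := hi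
          rw [extendByZero_apply]
        · rw [hz i fun h => hi ((hJ i).mp h)]
          push Not at hi
          exact extendByZero_apply_of_notMem g _ hi
      refine ⟨⟨fun j => z (g j), fun h => hz0 ?_⟩, hzx⟩
      rw [← hzx, h]
      simp [extendByZero]
  rw [hrange] at e
  exact ⟨e⟩

end Extension

/-- In this product the zero-divisors are exactly the nonunits: if `z i` is a nonunit, a nonzero `t`
in `R i` killing all nonunits gives `Pi.single i t`, which annihilates `z`. -/
theorem nonempty_reducedHomology_K_equiv {Ω : Type*} [CommRing Ω] {ι : Type*} [Fintype ι]
    {R : ι → Type*} [∀ i, CommRing (R i)] [∀ i, Finite (R i)] [∀ i, IsLocalRing (R i)]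
    [LinearOrder ((i : ι) → R i)] (e : Ω ≃+* ((i : ι) → R i)) (n : ℤ) :
    Nonempty (reducedHomology (K Ω) n ≃ₗ[ℤ]
      FamilyHomology (cliqueFamily {z : (i : ι) → R i | z ≠ 0 ∧ ¬ IsUnit z}) n) := by
  classical
  let f : nonzeroZeroDivisors Ω ↪ ((i : ι) → R i) :=
    ⟨fun x => e x, e.injective.comp Subtype.val_injective⟩
  obtain ⟨e'⟩ := nonempty_reducedHomology_cliqueComplex_equiv f
    (fun x y => by
      change e x * e y = 0 ↔ _
      rw [← map_mul, map_eq_zero_iff e e.injective]) n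
  have hrange : Set.range f = {z : (i : ι) → R i | z ≠ 0 ∧ ¬ IsUnit z} := by
    ext z
    constructor
    · rintro ⟨⟨x, hx0, y, hy0, hxy⟩, rfl⟩
      refine ⟨fun h => hx0 ((map_eq_zero_iff e e.injective).mp h), fun h => hy0 ?_⟩
      have hx : IsUnit x := (MulEquiv.isUnit_map e).mp h
      exact hx.mul_right_eq_zero.mp hxy
    · rintro ⟨hz0, hz⟩
      rw [Pi.isUnit_iff] at hz
      push Not at hz
      obtain ⟨i, hi⟩ := hz
      obtain ⟨t, ht0, ht⟩ := exists_ne_zero_mul_eq_zero_of_not_isUnit (R i)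
      refine ⟨⟨e.symm z, fun h => hz0 ?_, e.symm (Pi.single i t), fun h => ht0 ?_, ?_⟩,
        e.apply_symm_apply z⟩
      · simpa using h
      · simpa using h
      · rw [← map_mul, ← Pi.single_mul_right, mul_comm, ht _ hi, Pi.single_zero, map_zero]
  rw [hrange] at e'
  exact ⟨e'⟩

/-! ### Counting the contributing vertices -/

section Count

theorem card_setOf_isUnit (B : Type*) [CommRing B] : Nat.card {x : B | IsUnit x} = Nat.card Bˣ :=
  Nat.card_range_of_injective (f := (Units.val : Bˣ → B)) Units.val_injective

/-- The elements of a product of rings that vanish exactly on `J`, all other components being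
units. -/
def zeroUnitSet {ι : Type*} (R : ι → Type*) [∀ i, CommRing (R i)] (J : Finset ι) :
    Set ((i : ι) → R i) :=
  {w | ∀ i, (i ∈ J → w i = 0) ∧ (i ∉ J → IsUnit (w i))}

variable {k : ℕ} {R : Fin (k + 1) → Type u} [∀ i, CommRing (R i)]

theorem ncard_zeroUnitSet (I : Finset (Fin k)) :
    (zeroUnitSet R (I.map Fin.castSuccEmb)).ncard
      = (∏ i ∈ Iᶜ, Nat.card (R i.castSucc)ˣ) * Nat.card (R (Fin.last k))ˣ := by
  classical
  set J := I.map Fin.castSuccEmb with hJ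
  have h1 : zeroUnitSet R J
      = Set.pi Set.univ fun i => if i ∈ J then {0} else {x : R i | IsUnit x} := by
    ext w
    simp only [zeroUnitSet, Set.mem_ofPred_eq, Set.mem_univ_pi]
    refine forall_congr' fun i => ?_
    by_cases hi : i ∈ J <;> simp [hi]
  have hlast : Fin.last k ∉ J := by
    simp [hJ, Fin.castSucc_ne_last]
  have hcast : ∀ i : Fin k, i.castSucc ∈ J ↔ i ∈ I := by
    simp [hJ]
  rw [h1, ← Nat.card_coe_set_eq, Nat.card_congr (Equiv.Set.univPi _), Nat.card_pi,
    Fin.prod_univ_castSucc, if_neg hlast, card_setOf_isUnit]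
  congr 1
  rw [← Finset.prod_subset (Finset.subset_univ Iᶜ)]
  · refine Finset.prod_congr rfl fun i hi => ?_
    rw [if_neg (by simpa [hcast] using hi), card_setOf_isUnit]
  · intro i _ hi
    rw [if_pos (by simpa [hcast] using hi)]
    simp

theorem isField_of_isUnit {B : Type*} [CommRing B] [Nontrivial B] {s : B} (hsu : IsUnit s)
    (hs : ∀ y, ¬ IsUnit y → s * y = 0) : IsField B where
  exists_pair_ne := exists_pair_ne B
  mul_comm := mul_comm
  mul_inv_cancel {y} hy := by
    by_contra h
    refine hy (hsu.mul_right_eq_zero.mp (hs y fun hu => h ?_))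
    exact hu.exists_right_inv

/-- The exceptional exponent comes from excluding the apex. The apex has this zero pattern only if
`I` is everything and `s` is a unit; as `s` is nonzero and kills all nonunits, the latter means that
the last factor is a field. -/
theorem ncard_zeroUnitSet_diff [∀ i, Finite (R i)] [∀ i, IsLocalRing (R i)] (I : Finset (Fin k))
    {s : R (Fin.last k)} (hs0 : s ≠ 0) (hs : ∀ y, ¬ IsUnit y → s * y = 0) :
    (zeroUnitSet R (I.map Fin.castSuccEmb) \ {Pi.single (Fin.last k) s}).ncard = exponent R I := by
  have key : Pi.single (Fin.last k) s ∈ zeroUnitSet R (I.map Fin.castSuccEmb) ↔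
      I = Finset.univ ∧ IsField (R (Fin.last k)) := by
    constructor
    · intro h
      constructor
      · refine Finset.eq_univ_of_forall fun i => ?_
        by_contra hi
        have := (h i.castSucc).2 (by simpa using hi)
        rw [Pi.single_eq_of_ne (Fin.castSucc_ne_last i)] at this
        exact not_isUnit_zero this
      · have := (h (Fin.last k)).2 (by simp [Fin.castSucc_ne_last])
        rw [Pi.single_eq_same] at this
        exact isField_of_isUnit this hs
    · rintro ⟨rfl, hF⟩ i
      refine Fin.lastCases ?_ (fun i => ?_) i
      · refine ⟨fun h => absurd h (by simp [Fin.castSucc_ne_last]), fun _ => ?_⟩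
        rw [Pi.single_eq_same]
        obtain ⟨b, hb⟩ := hF.mul_inv_cancel hs0
        exact IsUnit.of_mul_eq_one b hb
      · exact ⟨fun _ => Pi.single_eq_of_ne (Fin.castSucc_ne_last i) _, fun h => by simp at h⟩
  unfold exponent
  split_ifs with h
  · rw [Set.ncard_sdiff_singleton_of_mem (key.mpr h), ncard_zeroUnitSet, h.1]
    simp
  · rw [Set.sdiff_singleton_eq_self (fun h' => h (key.mp h')), ncard_zeroUnitSet]

end Count

theorem nonempty_familyHomology_nonunits_equiv {k : ℕ} {R : Fin (k + 1) → Type u}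
    [∀ i, CommRing (R i)] [∀ i, Finite (R i)] [∀ i, IsLocalRing (R i)]
    [LinearOrder ((i : Fin (k + 1)) → R i)] {s : R (Fin.last k)} (hs0 : s ≠ 0)
    (hs : ∀ y, ¬ IsUnit y → s * y = 0)
    (hsu : ¬ IsUnit (Pi.single (Fin.last k) s : (i : Fin (k + 1)) → R i)) (n : ℤ) :
    Nonempty (FamilyHomology (cliqueFamily {z : (i : Fin (k + 1)) → R i | z ≠ 0 ∧ ¬ IsUnit z}) n
      ≃ₗ[ℤ] ((I : {I : Finset (Fin k) // I.Nonempty}) → Fin (exponent R I.1) →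
        FamilyHomology (cliqueFamily (supportedOn R (I.1.map Fin.castSuccEmb))) (n - 1))) := by
  classical
  set S := {z : (i : Fin (k + 1)) → R i | z ≠ 0 ∧ ¬ IsUnit z} with hS
  obtain ⟨m, rfl⟩ : ∃ m, n = m + 1 := ⟨n - 1, by ring⟩
  obtain ⟨e⟩ := nonempty_familyHomology_product_equiv (Finset.mem_univ (Fin.last k)) (S := S)
    (fun z hz => ⟨hz.1, fun i hi => absurd (Finset.mem_univ i) hi⟩)
    (fun z hz hzu => ⟨hz.1, fun h => hzu (Pi.isUnit_iff.mp h _)⟩) hs ⟨by simpa using hs0, hsu⟩ m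
  rw [add_sub_cancel_right]
  set W := {w : (i : Fin (k + 1)) → R i | w ∈ S ∧ IsUnit (w (Fin.last k)) ∧
    w ≠ Pi.single (Fin.last k) s ∧ ∀ i, w i = 0 ∨ IsUnit (w i)} with hW
  -- The zero set is nonempty: `w` is not a unit, its last entry is one, and every other entry is
  -- zero or a unit.
  let q : W → {I : Finset (Fin k) // I.Nonempty} := fun w =>
    ⟨Finset.univ.filter fun i => w.1 i.castSucc = 0, by
      obtain ⟨w, hwS, hwl, -, hw⟩ := w
      have := hwS.2
      rw [Pi.isUnit_iff] at this
      push Not at this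
      obtain ⟨i, hi⟩ := this
      induction i using Fin.lastCases with
      | last => exact absurd hwl hi
      | cast i => exact ⟨i, by simpa using (hw _).resolve_right hi⟩⟩
  have hq : ∀ (w : W) (I), q w = I ↔ w.1 ∈ zeroUnitSet R (I.1.map Fin.castSuccEmb) := by
    rintro ⟨w, hwS, hwl, hwc, hw⟩ I
    rw [Subtype.ext_iff, Finset.ext_iff]
    simp only [q, Finset.mem_filter, Finset.mem_univ, true_and]
    constructor
    · intro h i
      refine Fin.lastCases ?_ (fun i => ?_) i
      · exact ⟨fun h => absurd h (by simp [Fin.castSucc_ne_last]), fun _ => hwl⟩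
      · have hi : i.castSucc ∈ I.1.map Fin.castSuccEmb ↔ i ∈ I.1 := by simp
        rw [hi, ← h i]
        exact ⟨id, (hw _).resolve_left⟩
    · intro h i
      have hi : i.castSucc ∈ I.1.map Fin.castSuccEmb ↔ i ∈ I.1 := by simp
      have h1 := h i.castSucc
      rw [hi] at h1
      refine ⟨fun h0 => ?_, h1.1⟩
      by_contra hiI
      exact (h1.2 hiI).ne_zero h0
  have hcard : ∀ I, Nat.card {w // q w = I} = exponent R I.1 := by
    intro I
    rw [← ncard_zeroUnitSet_diff I.1 hs0 hs, ← Nat.card_coe_set_eq]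
    refine Nat.card_congr
      { toFun := fun w => ⟨w.1.1, (hq _ _).mp w.2, w.1.2.2.2.1⟩
        invFun := fun w => ⟨⟨w.1, ?_⟩, (hq _ _).mpr w.2.1⟩
        left_inv := fun _ => rfl
        right_inv := fun _ => rfl }
    have hl : IsUnit (w.1 (Fin.last k)) := (w.2.1 _).2 (by simp [Fin.castSucc_ne_last])
    refine ⟨⟨fun h => hl.ne_zero (by rw [h]; rfl), fun h => ?_⟩, hl, w.2.2, fun i => ?_⟩
    · obtain ⟨i, hi⟩ := I.2
      have h1 := (w.2.1 i.castSucc).1 (by simpa using hi)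
      exact (Pi.isUnit_iff.mp h i.castSucc).ne_zero h1
    · by_cases hi : i ∈ I.1.map Fin.castSuccEmb
      · exact Or.inl ((w.2.1 i).1 hi)
      · exact Or.inr ((w.2.1 i).2 hi)
  obtain ⟨e'⟩ := nonempty_pi_equiv_pi_of_card_fiber
    (fun w : W => FamilyHomology (cliqueFamily (supportedOn R (zerosIn Finset.univ w.1))) m)
    (fun I : {I : Finset (Fin k) // I.Nonempty} =>
      FamilyHomology (cliqueFamily (supportedOn R (I.1.map Fin.castSuccEmb))) m)
    q (fun I => exponent R I.1) hcard (fun w I hwI => by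
      have hz : zerosIn Finset.univ w.1 = I.1.map Fin.castSuccEmb := by
        ext i
        have h := (hq w I).mp hwI i
        simp only [zerosIn, Finset.mem_filter, Finset.mem_univ, true_and]
        exact ⟨fun h0 => by_contra fun hi => (h.2 hi).ne_zero h0, h.1⟩
      rw [hz]
      exact ⟨LinearEquiv.refl ℤ _⟩)
  exact ⟨e.trans e'⟩

/-- If the element `s` of the last factor is annihilated by all nonunits and generates the unit
ideal of the product, then the product consists of one factor, which is a field. -/
theorem isUnit_of_isUnit_single {k : ℕ} {R : Fin (k + 1) → Type u} [∀ i, CommRing (R i)]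
    [∀ i, Nontrivial (R i)] {s : R (Fin.last k)} (hs : ∀ y, ¬ IsUnit y → s * y = 0)
    (hsu : IsUnit (Pi.single (Fin.last k) s : (i : Fin (k + 1)) → R i)) :
    k = 0 ∧ ∀ z : (i : Fin (k + 1)) → R i, z ≠ 0 → IsUnit z := by
  rw [Pi.isUnit_iff] at hsu
  have hlast : ∀ i, i = Fin.last k := by
    intro i
    by_contra hi
    have := hsu i
    rw [Pi.single_eq_of_ne hi] at this
    exact not_isUnit_zero this
  refine ⟨congrArg Fin.val (hlast 0).symm, fun z hz => ?_⟩
  rw [Pi.isUnit_iff]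
  intro i
  obtain rfl := hlast i
  by_contra hu
  have h1 := hsu (Fin.last k)
  rw [Pi.single_eq_same] at h1
  have h2 : z (Fin.last k) = 0 := h1.mul_right_eq_zero.mp (hs _ hu)
  refine hz (funext fun i => ?_)
  obtain rfl := hlast i
  exact h2

end ZeroDivisorComplex

end

theorem mainTheorem1 {k : ℕ} {Ω : Type*} [CommRing Ω] [Finite Ω]
    {R : Fin (k + 1) → Type*} [∀ i, CommRing (R i)] [∀ i, Finite (R i)] [∀ i, IsLocalRing (R i)]
    (e : Ω ≃+* ((i : Fin (k + 1)) → R i)) (n : ℤ) :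
    Module.Free ℤ (ZeroDivisorComplex.reducedHomology (ZeroDivisorComplex.K Ω) n) ∧
    (¬ (IsField Ω ∧ n = -1) →
      Nonempty (ZeroDivisorComplex.reducedHomology (ZeroDivisorComplex.K Ω) n ≃+
        ⨁ I : {I : Finset (Fin k) // I.Nonempty},
          (Fin (ZeroDivisorComplex.exponent R I.1) →
            ZeroDivisorComplex.reducedHomology
              (ZeroDivisorComplex.K₀ ((i : I.1) → R (Fin.castSucc i.1))) (n - 1)))) := by
  classical
  open ZeroDivisorComplex in
  let _ : LinearOrder ((i : Fin (k + 1)) → R i) :=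
    linearOrderOfSTO (WellOrderingRel (α := (i : Fin (k + 1)) → R i))
  obtain ⟨e₁⟩ := nonempty_reducedHomology_K_equiv e n
  obtain ⟨s, hs0, hs⟩ := exists_ne_zero_mul_eq_zero_of_not_isUnit (R (Fin.last k))
  by_cases hsu : IsUnit (Pi.single (Fin.last k) s : (i : Fin (k + 1)) → R i)
  -- Here the apex is a unit, hence not a vertex of `K(Ω)`. Then `Ω` is a field, the only face is
  -- the empty one, and the right-hand sum has no terms; the two sides agree outside degree `-1`.
  · obtain ⟨rfl, hu⟩ := isUnit_of_isUnit_single hs hsu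
    have hempty : {z : (i : Fin (0 + 1)) → R i | z ≠ 0 ∧ ¬ IsUnit z} = ∅ :=
      Set.eq_empty_of_forall_notMem fun z hz => hz.2 (hu z hz.1)
    rw [hempty, cliqueFamily_empty] at e₁
    have hfree := free_familyHomology_singleton_empty (V := (i : Fin (0 + 1)) → R i) n
    refine ⟨Module.Free.of_equiv e₁.symm, fun hn => ?_⟩
    have hΩ : IsField Ω :=
      { exists_pair_ne := e.toEquiv.nontrivial.exists_pair_ne
        mul_comm := mul_comm
        mul_inv_cancel := fun {x} hx => by
          have h1 : IsUnit (e x) := hu _ fun h => hx ((map_eq_zero_iff e e.injective).mp h)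
          exact ((MulEquiv.isUnit_map e).mp h1).exists_right_inv }
    have hsub := subsingleton_familyHomology_singleton_empty (V := (i : Fin (0 + 1)) → R i)
      fun h => hn ⟨hΩ, h⟩
    have hsub' := e₁.toEquiv.subsingleton
    have : IsEmpty {I : Finset (Fin 0) // I.Nonempty} := ⟨fun I => I.2.choose.elim0⟩
    exact ⟨{ toFun := 0, invFun := 0, left_inv := fun _ => Subsingleton.elim _ _,
             right_inv := fun _ => Subsingleton.elim _ _, map_add' := fun _ _ => Subsingleton.elim _ _ }⟩
  · obtain ⟨e₂⟩ := nonempty_familyHomology_nonunits_equiv hs0 hs hsu n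
    have hfree := fun J => free_familyHomology_supportedOn (R := R) J (n - 1)
    refine ⟨Module.Free.of_equiv (e₁.trans e₂).symm, fun _ => ?_⟩
    let e₃ := fun I : {I : Finset (Fin k) // I.Nonempty} =>
      (nonempty_reducedHomology_K₀_equiv (R := R)
        ((Function.Embedding.subtype (· ∈ I.1)).trans Fin.castSuccEmb)
        (I.1.map Fin.castSuccEmb) (fun i => by simp) (n - 1)).some
    refine ⟨AddEquiv.trans ?_ (DirectSum.addEquivProd _).symm⟩
    exact (e₁.trans e₂).toAddEquiv.trans (AddEquiv.piCongrRight fun I =>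
      AddEquiv.piCongrRight fun _ => (e₃ I).symm.toAddEquiv)
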